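/- Let $k$ be a field and let $d\ge 1$. A standard graded $k$-algebra is an $\mathbb N$-graded commutative $k$-algebra $R=\bigoplus_{i\ge 0}R_i$ generated as a $k$-algebra by finitely many forms of degree one; put $\mathfrak m=\bigoplus_{i>0}R_i$. For a homogeneous ideal $J\subseteq R$ let $\widetilde J=\bigcup_{t\ge 0}(J:\mathfrak m^t)$ be its saturation, and let $\operatorname{sdeg} J$ be the least integer $t\ge 0$ such that $\widetilde J_j=J_j$ for all $j\ge t$, with $\operatorname{sdeg} J=-\infty$ if $\widetilde J=J$. If an ideal $I$ of $R$ is generated by forms of degree $d$, the sequence $\operatorname{sdeg} I^n-dn$ $(n\ge 1)$ is called the defect sequence of the function $\operatorname{sdeg} I^n$. Theorem. Let $\{b_n\}_{n\ge 1}$ be a sequence of non-negative integers. There exist a standard graded $k$-algebra $R$ and an ideal $I$ of $R$ generated by forms of degree $d$ with $\dim R/I=0$ such that $\{b_n\}$ is the defect sequence of the function $\operatorname{sdeg} I^n$ (that is, $\operatorname{sdeg} I^n=dn+b_n$ for all $n\ge 1$) if and only if $b_{n+1}\le b_n$ and $b_n-b_{n+1}\le d$ for all $n\ge 1$. -/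

import Mathlib

universe u

namespace SatDegree

section GradedRing

variable {k R : Type u} [Field k] [CommRing R] [Algebra k R]

/-- A standard graded `k`-algebra: an `ℕ`-graded `k`-algebra which is generated, as a `k`-algebra,
by finitely many forms of degree one. (In particular the component of degree zero is the image
of `k`.) -/
def IsStandardGraded (𝒜 : ℕ → Submodule k R) [GradedAlgebra 𝒜] : Prop :=
  ∃ s : Finset R, (∀ x ∈ s, x ∈ 𝒜 1) ∧ Algebra.adjoin k (s : Set R) = ⊤

/-- The ideal `I` is generated by forms of degree `d`. -/
def GeneratedInDegree (𝒜 : ℕ → Submodule k R) (I : Ideal R) (d : ℕ) : Prop :=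
  ∃ S : Set R, (∀ x ∈ S, x ∈ 𝒜 d) ∧ I = Ideal.span S

/-- The saturation `⋃ₜ (I : 𝔪ᵗ)` of an ideal `I`, where `𝔪 = ⨁_{i > 0} Rᵢ`. The ideals
`I : 𝔪ᵗ` form an increasing chain, so that their supremum is their union. -/
noncomputable def saturation (𝒜 : ℕ → Submodule k R) [GradedAlgebra 𝒜] (I : Ideal R) : Ideal R :=
  ⨆ t : ℕ, I.colon (((HomogeneousIdeal.irrelevant 𝒜).toIdeal ^ t : Ideal R) : Set R)

/-- `I` agrees with its saturation in degree `t` and higher. -/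
def AgreesWithSaturationFrom (𝒜 : ℕ → Submodule k R) [GradedAlgebra 𝒜] (I : Ideal R)
    (t : ℕ) : Prop :=
  ∀ j : ℕ, t ≤ j → ∀ x ∈ 𝒜 j, (x ∈ saturation 𝒜 I ↔ x ∈ I)

open Classical in
/-- The saturation degree: the least number `t` such that `I` agrees with its saturation in
degree `t` and higher, with the convention `sdeg I = -∞` (that is, `⊥`) if `I` is saturated.
For an ideal of a standard graded algebra such a `t` exists, because the
saturation modulo `I` is annihilated by a power of `𝔪` and finitely generated. -/
noncomputable def sdeg (𝒜 : ℕ → Submodule k R) [GradedAlgebra 𝒜] (I : Ideal R) : WithBot ℕ :=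
  if saturation 𝒜 I = I then ⊥
  else ((sInf {t : ℕ | AgreesWithSaturationFrom 𝒜 I t} : ℕ) : WithBot ℕ)

/-- `b₁, b₂, …` is the defect sequence `bₙ = sdeg Iⁿ - d n` (for `n ≥ 1`) of the function
`n ↦ sdeg Iⁿ`. The value `b 0` plays no role. -/
def IsSdegDefectSequence (𝒜 : ℕ → Submodule k R) [GradedAlgebra 𝒜] (I : Ideal R) (d : ℕ)
    (b : ℕ → ℕ) : Prop :=
  ∀ n : ℕ, 1 ≤ n → sdeg 𝒜 (I ^ n) = ((d * n + b n : ℕ) : WithBot ℕ)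

end GradedRing

end SatDegree

/-! Since `R/I` has dimension zero, `I` and all its powers contain every form of large degree. So
each power saturates to `⊤`, and `sdeg (I ^ n)` is the least degree from which `I ^ n` contains all
forms (`sdeg_eq_coe_iff`). Necessity: `I ^ (n+1) ≤ I ^ n` makes `d * n + b n` nondecreasing.
Conversely, a form of `I` of degree `j` is a combination of generators with coefficients of degree
`j - d`, so passing from `I ^ n` to `I * I ^ n` costs at most `d` degrees
(`GeneratedInDegree.mem_mul`). Sufficiency: take `k[x, y]` modulo a monomial staircase with steps of
width `d` and heights `b 1, b 2, …`, and `I = (x ^ d)`. The monomials outside `I ^ n` fill the first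
`n` steps, and their top degree is `d * n + b n - 1`. -/

namespace SatDegree

/-! ### Forms of large degree and necessity -/

section GradedRing

variable {k R : Type u} [Field k] [CommRing R] [Algebra k R]

open DirectSum

/-- In a graded algebra generated by a set `s` of forms of degree one, the forms of degree `j` lie
in the `j`-th power of the ideal generated by `s`. -/
theorem mem_span_pow_of_mem_of_adjoin_eq_top (𝒜 : ℕ → Submodule k R) [GradedAlgebra 𝒜] {s : Set R}
    (hs : ∀ x ∈ s, x ∈ 𝒜 1) (htop : Algebra.adjoin k s = ⊤) {j : ℕ} {x : R} (hx : x ∈ 𝒜 j) :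
    x ∈ Ideal.span s ^ j := by
  have hmon : ∀ y ∈ Submonoid.closure s, ∃ i, y ∈ 𝒜 i ∧ y ∈ Ideal.span s ^ i := by
    intro y hy
    induction hy using Submonoid.closure_induction with
    | mem y hy => exact ⟨1, hs y hy, by simpa using Ideal.subset_span hy⟩
    | one => exact ⟨0, SetLike.GradedOne.one_mem, by simp⟩
    | mul y z _ _ hy hz =>
      obtain ⟨i, hyi, hyi'⟩ := hy
      obtain ⟨l, hzl, hzl'⟩ := hz
      exact ⟨i + l, SetLike.GradedMul.mul_mem hyi hzl, by
        rw [pow_add]; exact Ideal.mul_mem_mul hyi' hzl'⟩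
  have key : ∀ y ∈ Submodule.span k (Submonoid.closure s : Set R),
      (decompose 𝒜 y j : R) ∈ Ideal.span s ^ j := by
    intro y hy
    induction hy using Submodule.span_induction with
    | mem y hy =>
      obtain ⟨i, hyi, hyi'⟩ := hmon y hy
      by_cases hij : i = j
      · subst hij
        rwa [decompose_of_mem_same 𝒜 hyi]
      · rw [decompose_of_mem_ne 𝒜 hyi hij]
        exact zero_mem _
    | zero => simp
    | add y z _ _ hy hz => simpa using add_mem hy hz
    | smul c y _ hy =>
      rw [decompose_smul, DirectSum.smul_apply, Submodule.coe_smul, Algebra.smul_def]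
      exact Ideal.mul_mem_left _ _ hy
  have hx' : x ∈ Submodule.span k (Submonoid.closure s : Set R) := by
    rw [← Algebra.adjoin_eq_span, htop]
    trivial
  simpa [decompose_of_mem_same 𝒜 hx] using key x hx'

/-- A form of degree one lies in every homogeneous maximal ideal. -/
theorem mem_of_mem_one_of_isMaximal (𝒜 : ℕ → Submodule k R) [GradedAlgebra 𝒜] {Q : Ideal R}
    (hQ : Q.IsHomogeneous 𝒜) (hmax : Q.IsMaximal) {x : R} (hx : x ∈ 𝒜 1) : x ∈ Q := by
  by_contra hxQ
  obtain ⟨y, hy⟩ := hmax.exists_inv hxQ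
  obtain ⟨z, hz, hyz⟩ := hy
  apply hmax.ne_top
  rw [Ideal.eq_top_iff_one]
  have h := hQ 0 hz
  have hzx : z = 1 - y * x := eq_sub_of_add_eq' hyz
  -- The degree-zero component of `1 - y * x` is `1`, as `x` has positive degree.
  rw [hzx, decompose_sub, DirectSum.sub_apply, AddSubgroupClass.coe_sub,
    decompose_of_mem_same 𝒜 (SetLike.GradedOne.one_mem),
    coe_decompose_mul_of_right_mem_of_not_le 𝒜 hx (by simp), sub_zero] at h
  exact h

/-- A minimal prime of a homogeneous ideal is homogeneous. -/
theorem isHomogeneous_of_mem_minimalPrimes (𝒜 : ℕ → Submodule k R) [GradedAlgebra 𝒜]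
    {I Q : Ideal R} (hI : I.IsHomogeneous 𝒜) (hQ : Q ∈ I.minimalPrimes) : Q.IsHomogeneous 𝒜 := by
  have hle : I ≤ (Q.homogeneousCore 𝒜).toIdeal := by
    rw [← hI.toIdeal_homogeneousCore_eq_self]
    exact Ideal.homogeneousCore_mono 𝒜 hQ.1.2
  have h := hQ.2 ⟨hQ.1.1.homogeneousCore, hle⟩ (Ideal.toIdeal_homogeneousCore_le 𝒜 Q)
  rw [Ideal.IsHomogeneous.iff_eq]
  exact le_antisymm (Ideal.toIdeal_homogeneousCore_le 𝒜 Q) h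

theorem GeneratedInDegree.isHomogeneous {𝒜 : ℕ → Submodule k R} [GradedAlgebra 𝒜] {I : Ideal R}
    {d : ℕ} (h : GeneratedInDegree 𝒜 I d) : I.IsHomogeneous 𝒜 := by
  obtain ⟨S, hS, rfl⟩ := h
  exact Ideal.homogeneous_span 𝒜 S fun x hx => ⟨d, hS x hx⟩

/-- A homogeneous ideal with zero-dimensional quotient contains all forms of large degree. -/
theorem exists_forall_le_of_krullDimLE_zero {𝒜 : ℕ → Submodule k R} [GradedAlgebra 𝒜]
    (h𝒜 : IsStandardGraded 𝒜) {I : Ideal R} (hI : I.IsHomogeneous 𝒜)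
    (hdim : Ring.KrullDimLE 0 (R ⧸ I)) : ∃ t, ∀ j, t ≤ j → ∀ x ∈ 𝒜 j, x ∈ I := by
  obtain ⟨s, hs, htop⟩ := h𝒜
  rw [Ideal.krullDimLE_zero_quotient_iff_forall_minimalPrimes_isMaximal] at hdim
  have hrad : Ideal.span (s : Set R) ≤ I.radical := by
    rw [← Ideal.sInf_minimalPrimes, Ideal.span_le]
    intro x hx
    rw [SetLike.mem_coe, Ideal.mem_sInf]
    intro Q hQ
    exact mem_of_mem_one_of_isMaximal 𝒜 (isHomogeneous_of_mem_minimalPrimes 𝒜 hI hQ)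
      (hdim Q hQ) (hs x hx)
  obtain ⟨t, ht⟩ := Ideal.exists_pow_le_of_le_radical_of_fg hrad ⟨s, rfl⟩
  exact ⟨t, fun j hj x hx => ht (Ideal.pow_le_pow_right hj
    (mem_span_pow_of_mem_of_adjoin_eq_top 𝒜 hs htop hx))⟩

open scoped Pointwise in
/-- An ideal containing all forms of degree at least `t` contains the `t`-th power of the
irrelevant ideal. -/
theorem irrelevant_pow_le (𝒜 : ℕ → Submodule k R) [GradedAlgebra 𝒜] {I : Ideal R} {t : ℕ}
    (h : ∀ j, t ≤ j → ∀ x ∈ 𝒜 j, x ∈ I) :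
    (HomogeneousIdeal.irrelevant 𝒜).toIdeal ^ t ≤ I := by
  rw [HomogeneousIdeal.irrelevant_eq_span, Submodule.span_pow, Submodule.span_le]
  have key : ∀ n : ℕ, ∀ x ∈ (⋃ i > 0, (𝒜 i : Set R)) ^ n, ∃ j, n ≤ j ∧ x ∈ 𝒜 j := by
    intro n
    induction n with
    | zero =>
      intro x hx
      rw [pow_zero, Set.mem_one] at hx
      exact ⟨0, le_rfl, hx ▸ SetLike.GradedOne.one_mem⟩
    | succ n ih =>
      intro x hx
      rw [pow_succ] at hx
      obtain ⟨y, hy, z, hz, rfl⟩ := hx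
      obtain ⟨j, hj, hyj⟩ := ih y hy
      simp only [Set.mem_iUnion] at hz
      obtain ⟨i, hi, hzi⟩ := hz
      exact ⟨j + i, by omega, SetLike.GradedMul.mul_mem hyj hzi⟩
  intro x hx
  obtain ⟨j, hj, hxj⟩ := key t x hx
  exact h j hj x hxj

theorem saturation_eq_top (𝒜 : ℕ → Submodule k R) [GradedAlgebra 𝒜] {I : Ideal R}
    (h : ∃ t, ∀ j, t ≤ j → ∀ x ∈ 𝒜 j, x ∈ I) : saturation 𝒜 I = ⊤ := by
  obtain ⟨t, ht⟩ := h
  rw [eq_top_iff, saturation]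
  refine le_trans ?_ (le_iSup _ t)
  intro x _
  rw [Submodule.mem_colon]
  intro p hp
  exact I.mul_mem_left x (irrelevant_pow_le 𝒜 ht hp)

/-- For a proper ideal containing all forms of large degree, the saturation degree is the least
degree from which on it contains all forms. -/
theorem sdeg_eq_coe_iff (𝒜 : ℕ → Submodule k R) [GradedAlgebra 𝒜] {I : Ideal R} (hI : I ≠ ⊤)
    (h : ∃ t, ∀ j, t ≤ j → ∀ x ∈ 𝒜 j, x ∈ I) {N : ℕ} :
    sdeg 𝒜 I = (N : WithBot ℕ) ↔ ∀ t, (∀ j, t ≤ j → ∀ x ∈ 𝒜 j, x ∈ I) ↔ N ≤ t := by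
  have hsat := saturation_eq_top 𝒜 h
  have hset : {t : ℕ | AgreesWithSaturationFrom 𝒜 I t} =
      {t | ∀ j, t ≤ j → ∀ x ∈ 𝒜 j, x ∈ I} := by
    ext t
    simp [AgreesWithSaturationFrom, hsat]
  rw [sdeg, if_neg (by rw [hsat]; exact hI.symm), hset, Nat.cast_inj]
  have hmono : ∀ t t', t ≤ t' → (∀ j, t ≤ j → ∀ x ∈ 𝒜 j, x ∈ I) →
      ∀ j, t' ≤ j → ∀ x ∈ 𝒜 j, x ∈ I := fun t t' htt' H j hj => H j (htt'.trans hj)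
  constructor
  · rintro rfl t
    exact ⟨fun ht => Nat.sInf_le ht, fun ht => hmono _ _ ht (Nat.sInf_mem h)⟩
  · intro H
    exact le_antisymm (Nat.sInf_le ((H N).2 le_rfl)) ((H _).1 (Nat.sInf_mem h))

/-- If `I` is generated in degree `d` and `K` contains all forms of degree `j - d`, then `I * K`
contains all forms of degree `j` in `I`. -/
theorem GeneratedInDegree.mem_mul {𝒜 : ℕ → Submodule k R} [GradedAlgebra 𝒜] {I K : Ideal R}
    {d j : ℕ} (h : GeneratedInDegree 𝒜 I d) (hdj : d ≤ j) (hK : ∀ x ∈ 𝒜 (j - d), x ∈ K) {x : R}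
    (hx : x ∈ 𝒜 j) (hxI : x ∈ I) : x ∈ I * K := by
  obtain ⟨S, hS, rfl⟩ := h
  -- The free multiplier `r` absorbs scalars in the span induction; projecting to degree `j` leaves
  -- only coefficients of degree `j - d`.
  have key : ∀ r : R, (decompose 𝒜 (r * x) j : R) ∈ Ideal.span S * K := by
    clear hx
    induction hxI using Submodule.span_induction with
    | mem y hy =>
      intro r
      rw [coe_decompose_mul_of_right_mem_of_le 𝒜 (hS y hy) hdj, mul_comm _ y]
      exact Ideal.mul_mem_mul (Ideal.subset_span hy) (hK _ (SetLike.coe_mem _))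
    | zero => simp
    | add y z _ _ hy hz => intro r; simpa [mul_add] using add_mem (hy r) (hz r)
    | smul c y _ hy => intro r; simpa [mul_assoc] using hy (r * c)
  simpa [decompose_of_mem_same 𝒜 hx] using key 1

theorem exists_forall_mem_pow {𝒜 : ℕ → Submodule k R} [GradedAlgebra 𝒜] {I : Ideal R}
    {d : ℕ} (hI : GeneratedInDegree 𝒜 I d) (h : ∃ t, ∀ j, t ≤ j → ∀ x ∈ 𝒜 j, x ∈ I) (n : ℕ) :
    ∃ t, ∀ j, t ≤ j → ∀ x ∈ 𝒜 j, x ∈ I ^ n := by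
  induction n with
  | zero => simp
  | succ n ih =>
    obtain ⟨t, ht⟩ := h
    obtain ⟨t', ht'⟩ := ih
    refine ⟨t + t' + d, fun j hj x hx => ?_⟩
    rw [pow_succ']
    exact hI.mem_mul (by omega) (ht' _ (by omega)) hx (ht j (by omega) x hx)

theorem IsSdegDefectSequence.succ_le_and_le_add {𝒜 : ℕ → Submodule k R} [GradedAlgebra 𝒜]
    (h𝒜 : IsStandardGraded 𝒜) {I : Ideal R} {d : ℕ} (hI : GeneratedInDegree 𝒜 I d)
    (hdim : ringKrullDim (R ⧸ I) = 0) {b : ℕ → ℕ} (hb : IsSdegDefectSequence 𝒜 I d b) {n : ℕ}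
    (hn : 1 ≤ n) : b (n + 1) ≤ b n ∧ b n ≤ b (n + 1) + d := by
  have : Nontrivial (R ⧸ I) := by
    by_contra hsub
    rw [not_nontrivial_iff_subsingleton] at hsub
    simp [ringKrullDim_eq_bot_of_subsingleton] at hdim
  have hne : I ≠ ⊤ := Ideal.Quotient.nontrivial_iff.1 this
  have hlarge := exists_forall_le_of_krullDimLE_zero h𝒜 hI.isHomogeneous
    (ringKrullDimZero_iff_ringKrullDim_eq_zero.2 hdim)
  have hpow : ∀ m, 1 ≤ m → ∀ t, (∀ j, t ≤ j → ∀ x ∈ 𝒜 j, x ∈ I ^ m) ↔ d * m + b m ≤ t :=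
    fun m hm => (sdeg_eq_coe_iff 𝒜 (fun h => hne (top_le_iff.1 (h ▸ Ideal.pow_le_self (by omega))))
      (exists_forall_mem_pow hI hlarge m)).1 (hb m hm)
  have hanti : ∀ m l, 1 ≤ m → m ≤ l → d * m + b m ≤ d * l + b l := fun m l hm hml =>
    (hpow m hm _).1 fun j hj x hx =>
      Ideal.pow_le_pow_right hml ((hpow l (hm.trans hml) _).2 le_rfl j hj x hx)
  have h1 := hanti n (n + 1) hn (by omega)
  have h2 : d * (n + 1) + b (n + 1) ≤ d * (n + 1) + b n := by
    refine (hpow (n + 1) (by omega) _).1 fun j hj x hx => ?_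
    rw [mul_add, mul_one] at hj
    rw [pow_succ']
    refine hI.mem_mul (by omega) (fun y hy => (hpow n hn _).2 le_rfl _ (by omega) y hy) hx ?_
    -- This gives `j ≥ d + b 1`, so that `x` itself lies in `I`, as `mem_mul` needs.
    have h3 := hanti 1 n le_rfl hn
    simpa using (hpow 1 le_rfl _).2 le_rfl j (by omega) x hx
  rw [mul_add, mul_one] at h1
  omega

end GradedRing

end SatDegree

namespace SatDegree

/-! ### Graded quotients and dimension zero -/

section GradedRing

variable {k R : Type u} [Field k] [CommRing R] [Algebra k R]

/-- If `I` contains all forms of large degree, then its quotient has dimension at most zero. -/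
theorem krullDimLE_zero_of_forall_mem {𝒜 : ℕ → Submodule k R} [GradedAlgebra 𝒜]
    (h𝒜 : IsStandardGraded 𝒜) {I : Ideal R} (h : ∃ t, ∀ j, t ≤ j → ∀ x ∈ 𝒜 j, x ∈ I) :
    Ring.KrullDimLE 0 (R ⧸ I) := by
  obtain ⟨s, hs, htop⟩ := h𝒜
  obtain ⟨t, ht⟩ := h
  rw [Ideal.krullDimLE_zero_quotient_iff_forall_minimalPrimes_isMaximal]
  intro Q hQ
  have hprime : Q.IsPrime := hQ.1.1
  have hsQ : ∀ x ∈ s, x ∈ Q := fun x hx => hprime.mem_of_pow_mem t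
    (hQ.1.2 (ht t le_rfl _ (by simpa using SetLike.pow_mem_graded t (hs x hx))))
  -- All generators lie in `Q`, so `k` surjects onto `R ⧸ Q`.
  have hconst : ∀ x : R, ∃ c : k, x - algebraMap k R c ∈ Q := by
    intro x
    have hx : x ∈ Algebra.adjoin k (s : Set R) := htop ▸ Algebra.mem_top
    induction hx using Algebra.adjoin_induction with
    | mem x hx => exact ⟨0, by simpa using hsQ x hx⟩
    | algebraMap c => exact ⟨c, by simp⟩
    | add x y _ _ hx hy =>
      obtain ⟨a, ha⟩ := hx
      obtain ⟨c, hc⟩ := hy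
      exact ⟨a + c, by rw [map_add, add_sub_add_comm]; exact add_mem ha hc⟩
    | mul x y _ _ hx hy =>
      obtain ⟨a, ha⟩ := hx
      obtain ⟨c, hc⟩ := hy
      refine ⟨a * c, ?_⟩
      have : x * y - algebraMap k R (a * c) =
          (x - algebraMap k R a) * y + algebraMap k R a * (y - algebraMap k R c) := by
        rw [map_mul]; ring
      rw [this]
      exact add_mem (Q.mul_mem_right _ ha) (Q.mul_mem_left _ hc)
  rw [Ideal.isMaximal_iff]
  refine ⟨fun h1 => hprime.ne_top ((Ideal.eq_top_iff_one Q).2 h1), fun J x hQJ hxQ hxJ => ?_⟩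
  obtain ⟨c, hc⟩ := hconst x
  have hc0 : c ≠ 0 := by
    rintro rfl
    exact hxQ (by simpa using hc)
  have hcJ : algebraMap k R c ∈ J := by simpa using sub_mem hxJ (hQJ hc)
  have := J.mul_mem_left (algebraMap k R c⁻¹) hcJ
  rwa [← map_mul, inv_mul_cancel₀ hc0, map_one] at this

/-- The grading induced on the quotient by an ideal. -/
def quotientGrading (𝒜 : ℕ → Submodule k R) (J : Ideal R) (i : ℕ) : Submodule k (R ⧸ J) :=
  (𝒜 i).map (Ideal.Quotient.mkₐ k J).toLinearMap

/-- Homogeneity gives independence: if a sum of components lies in `J`, each component does. -/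
theorem isInternal_quotientGrading (𝒜 : ℕ → Submodule k R) [GradedAlgebra 𝒜] {J : Ideal R}
    (hJ : J.IsHomogeneous 𝒜) : DirectSum.IsInternal (quotientGrading 𝒜 J) := by
  let f : ∀ i, 𝒜 i →+ quotientGrading 𝒜 J i := fun i =>
    ((Ideal.Quotient.mkₐ k J).toLinearMap.submoduleMap (𝒜 i)).toAddMonoidHom
  have hf : Function.Surjective (DirectSum.map f) :=
    (DirectSum.map_surjective f).2 fun i => LinearMap.submoduleMap_surjective _ _
  have hcoe : ∀ w, DirectSum.coeAddMonoidHom (quotientGrading 𝒜 J) (DirectSum.map f w) =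
      Ideal.Quotient.mk J (DirectSum.coeAddMonoidHom 𝒜 w) := by
    intro w
    induction w using DirectSum.induction_on with
    | zero => simp
    | of i x =>
      rw [DirectSum.map_of, DirectSum.coeAddMonoidHom_of, DirectSum.coeAddMonoidHom_of]
      rfl
    | add x y hx hy => simp only [map_add, hx, hy]
  refine ⟨(injective_iff_map_eq_zero _).2 fun z hz => ?_, fun x => ?_⟩
  · obtain ⟨w, rfl⟩ := hf z
    rw [hcoe, Ideal.Quotient.eq_zero_iff_mem] at hz
    ext i
    have hwi := hJ i hz
    have hdec : DirectSum.decompose 𝒜 (DirectSum.coeAddMonoidHom 𝒜 w) = w :=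
      (DirectSum.decompose 𝒜).right_inv w
    rw [hdec] at hwi
    rw [DirectSum.map_apply]
    exact Ideal.Quotient.eq_zero_iff_mem.2 hwi
  · obtain ⟨y, rfl⟩ := Ideal.Quotient.mk_surjective x
    refine ⟨DirectSum.map f (DirectSum.decompose 𝒜 y), ?_⟩
    rw [hcoe]
    exact congrArg _ ((DirectSum.decompose 𝒜).left_inv y)

/-- The quotient of a graded algebra by a homogeneous ideal is graded. -/
noncomputable abbrev quotientGradedAlgebra (𝒜 : ℕ → Submodule k R) [GradedAlgebra 𝒜] {J : Ideal R}
    (hJ : J.IsHomogeneous 𝒜) : GradedAlgebra (quotientGrading 𝒜 J) where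
  one_mem := ⟨1, SetLike.GradedOne.one_mem, map_one (Ideal.Quotient.mk J)⟩
  mul_mem := by
    rintro i j _ _ ⟨x, hx, rfl⟩ ⟨y, hy, rfl⟩
    exact ⟨x * y, SetLike.GradedMul.mul_mem hx hy, map_mul (Ideal.Quotient.mk J) x y⟩
  toDecomposition := (isInternal_quotientGrading 𝒜 hJ).chooseDecomposition

theorem IsStandardGraded.quotient {𝒜 : ℕ → Submodule k R} [GradedAlgebra 𝒜]
    (h𝒜 : IsStandardGraded 𝒜) {J : Ideal R} [GradedAlgebra (quotientGrading 𝒜 J)] :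
    IsStandardGraded (quotientGrading 𝒜 J) := by
  classical
  obtain ⟨s, hs, htop⟩ := h𝒜
  refine ⟨s.image (Ideal.Quotient.mkₐ k J), ?_, ?_⟩
  · intro x hx
    obtain ⟨y, hy, rfl⟩ := Finset.mem_image.1 hx
    exact ⟨y, hs y hy, rfl⟩
  · rw [Finset.coe_image, ← AlgHom.map_adjoin, htop, Algebra.map_top, AlgHom.range_eq_top]
    exact Ideal.Quotient.mkₐ_surjective k J

end GradedRing

/-! ### The staircase algebra and sufficiency -/

section StaircaseAlgebra

open MvPolynomial

attribute [local instance] MvPolynomial.gradedAlgebra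

variable (k : Type u) [Field k] (d : ℕ) (b : ℕ → ℕ)

theorem isStandardGraded_homogeneousSubmodule (n : ℕ) :
    IsStandardGraded (homogeneousSubmodule (Fin n) k) := by
  classical
  refine ⟨Finset.univ.image X, ?_, ?_⟩
  · intro x hx
    obtain ⟨i, -, rfl⟩ := Finset.mem_image.1 hx
    exact isHomogeneous_X k i
  · rw [Finset.coe_image, Finset.coe_univ, Set.image_univ, adjoin_range_X]

/-- The exponents `(a, c)` with `c > b (⌊a / d⌋ + 1)`. -/
def staircase : Set (Fin 2 →₀ ℕ) :=
  {e | b (e 0 / d + 1) < e 1}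

/-- The ideal of `k[x, y]` generated by the monomials `x ^ a * y ^ c` with
`c > b (⌊a / d⌋ + 1)`. -/
noncomputable def staircaseIdeal : Ideal (MvPolynomial (Fin 2) k) :=
  Ideal.span ((fun e => monomial e (1 : k)) '' staircase d b)

theorem isHomogeneous_staircaseIdeal :
    (staircaseIdeal k d b).IsHomogeneous (homogeneousSubmodule (Fin 2) k) := by
  refine Ideal.homogeneous_span _ _ ?_
  rintro _ ⟨e, -, rfl⟩
  exact ⟨e.degree, isHomogeneous_monomial 1 rfl⟩

/-- The ideal generated by `x ^ d` in the quotient of `k[x, y]` by the staircase ideal. -/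
noncomputable def xPowIdeal : Ideal (MvPolynomial (Fin 2) k ⧸ staircaseIdeal k d b) :=
  Ideal.span {Ideal.Quotient.mk _ (X 0 ^ d)}

variable {k d b}

theorem generatedInDegree_xPowIdeal :
    GeneratedInDegree (quotientGrading (homogeneousSubmodule (Fin 2) k) (staircaseIdeal k d b))
      (xPowIdeal k d b) d := by
  refine ⟨_, ?_, rfl⟩
  rintro _ rfl
  exact ⟨_, isHomogeneous_X_pow 0 d, rfl⟩

/-- The preimage of the power is a monomial ideal. Monotonicity of `b` makes the staircase closed
under increasing exponents, so divisibility by a generator reduces to an inequality. -/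
theorem mk_mem_xPowIdeal_pow_iff (hb : ∀ n, 1 ≤ n → b (n + 1) ≤ b n) (n : ℕ)
    (p : MvPolynomial (Fin 2) k) :
    Ideal.Quotient.mk (staircaseIdeal k d b) p ∈ xPowIdeal k d b ^ n ↔
      ∀ e ∈ p.support, d * n ≤ e 0 ∨ b (e 0 / d + 1) < e 1 := by
  have hanti : ∀ m l, m ≤ l → b (l + 1) ≤ b (m + 1) := fun m l hml =>
    antitone_nat_of_succ_le (f := fun i => b (i + 1)) (fun i => hb (i + 1) (by omega)) hml
  have hmap : xPowIdeal k d b ^ n = Ideal.map (Ideal.Quotient.mk (staircaseIdeal k d b))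
      (Ideal.span ((fun e => monomial e (1 : k)) '' {Finsupp.single 0 (d * n)})) := by
    rw [xPowIdeal, Ideal.span_singleton_pow, Ideal.map_span, Set.image_singleton,
      Set.image_singleton, ← map_pow, ← pow_mul, X_pow_eq_monomial]
  rw [hmap, Ideal.mem_quotient_iff_mem_sup, staircaseIdeal, ← Ideal.span_union,
    ← Set.image_union, mem_ideal_span_monomial_image]
  refine forall₂_congr fun e _ => ⟨?_, ?_⟩
  · rintro ⟨f, rfl | hf, hfe⟩
    · exact Or.inl (by simpa using hfe 0)
    · exact Or.inr (((hanti _ _ (Nat.div_le_div_right (hfe 0))).trans_lt hf).trans_le (hfe 1))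
  · rintro (h | h)
    · exact ⟨_, Or.inl rfl, Finsupp.single_le_iff.2 h⟩
    · exact ⟨e, Or.inr h, le_rfl⟩

theorem xPowIdeal_pow_forms_iff (hd : 1 ≤ d) (hb : ∀ n, 1 ≤ n → b (n + 1) ≤ b n)
    (hb' : ∀ n, 1 ≤ n → b n ≤ b (n + 1) + d) {n : ℕ} (hn : 1 ≤ n) (t : ℕ) :
    (∀ j, t ≤ j → ∀ x ∈ quotientGrading (homogeneousSubmodule (Fin 2) k) (staircaseIdeal k d b) j,
      x ∈ xPowIdeal k d b ^ n) ↔ d * n + b n ≤ t := by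
  constructor
  · intro h
    by_contra! hlt
    obtain ⟨m, rfl⟩ : ∃ m, n = m + 1 := ⟨n - 1, by omega⟩
    rw [mul_add, mul_one] at hlt
    -- The outer corner of the last step: a monomial outside the power, of degree `d * n + b n - 1`.
    let e : Fin 2 →₀ ℕ := Finsupp.single 0 (d * m + (d - 1)) + Finsupp.single 1 (b (m + 1))
    have he0 : e 0 = d * m + (d - 1) := by simp [e]
    have he1 : e 1 = b (m + 1) := by simp [e]
    have hdeg : e.degree = d * m + (d - 1) + b (m + 1) := by
      rw [map_add, Finsupp.degree_single, Finsupp.degree_single]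
    have hmem := (mk_mem_xPowIdeal_pow_iff hb (m + 1) (monomial e (1 : k))).1
      (h e.degree (by omega) _ ⟨_, isHomogeneous_monomial 1 rfl, rfl⟩) e (by simp)
    rw [he0, he1, Nat.mul_add_div (by omega), Nat.div_eq_of_lt (by omega), mul_add] at hmem
    simp only [add_zero, lt_irrefl, or_false] at hmem
    omega
  · rintro ht j hj _ ⟨p, hp, rfl⟩
    refine (mk_mem_xPowIdeal_pow_iff hb n p).2 fun e he => ?_
    by_contra! hcon
    have hdeg : e 0 + e 1 = j := by
      have := hp (mem_support_iff.1 he)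
      rw [← this, Finsupp.weight_apply, Finsupp.sum_fintype _ _ (by simp)]
      simp
    have hq : e 0 / d < n := Nat.div_lt_of_lt_mul hcon.1
    -- As `b` drops by at most `d` per step, corner degrees never decrease, so the last step
    -- dominates.
    have hmono : d * (e 0 / d + 1) + b (e 0 / d + 1) ≤ d * n + b n := by
      have := monotone_nat_of_le_succ (f := fun i => d * (i + 1) + b (i + 1)) (fun i => by
        have := hb' (i + 1) (by omega)
        rw [mul_add d (i + 1) 1]
        omega) (show e 0 / d ≤ n - 1 by omega)
      simpa [Nat.sub_add_cancel hn] using this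
    have := Nat.lt_mul_div_succ (e 0) (show 0 < d by omega)
    omega

end StaircaseAlgebra

end SatDegree

theorem theorem4p8 (k : Type u) [Field k] (d : ℕ) (hd : 1 ≤ d) (b : ℕ → ℕ) :
    (∃ (R : Type u) (_ : CommRing R) (_ : Algebra k R) (𝒜 : ℕ → Submodule k R)
        (_ : GradedAlgebra 𝒜) (I : Ideal R),
        SatDegree.IsStandardGraded 𝒜 ∧
        SatDegree.GeneratedInDegree 𝒜 I d ∧
        ringKrullDim (R ⧸ I) = 0 ∧
        SatDegree.IsSdegDefectSequence 𝒜 I d b) ↔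
      ((∀ n : ℕ, 1 ≤ n → b (n + 1) ≤ b n) ∧
        (∀ n : ℕ, 1 ≤ n → (b n : ℤ) - (b (n + 1) : ℤ) ≤ (d : ℤ))) := by
  constructor
  · rintro ⟨R, _, _, 𝒜, _, I, h𝒜, hI, hdim, hb⟩
    have h := fun n (hn : 1 ≤ n) => hb.succ_le_and_le_add h𝒜 hI hdim hn
    exact ⟨fun n hn => (h n hn).1, fun n hn => by have := (h n hn).2; omega⟩
  · rintro ⟨hb, hb'⟩
    replace hb' : ∀ n, 1 ≤ n → b n ≤ b (n + 1) + d := fun n hn => by have := hb' n hn; omega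
    let := MvPolynomial.gradedAlgebra (R := k) (σ := Fin 2)
    let := SatDegree.quotientGradedAlgebra
      (MvPolynomial.homogeneousSubmodule (Fin 2) k) (SatDegree.isHomogeneous_staircaseIdeal k d b)
    have hforms := fun n (hn : 1 ≤ n) t =>
      SatDegree.xPowIdeal_pow_forms_iff (k := k) hd hb hb' hn t
    have hst := (SatDegree.isStandardGraded_homogeneousSubmodule k 2).quotient
      (J := SatDegree.staircaseIdeal k d b)
    have hne : ∀ n, 1 ≤ n → SatDegree.xPowIdeal k d b ^ n ≠ ⊤ := fun n hn htop => by
      have h0 := (hforms n hn 0).1 (by simp [htop])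
      have := Nat.mul_pos hd hn
      omega
    refine ⟨_, _, _, _, this, SatDegree.xPowIdeal k d b, hst,
      SatDegree.generatedInDegree_xPowIdeal, ?_, fun n hn => ?_⟩
    · have : Nontrivial (_ ⧸ SatDegree.xPowIdeal k d b) :=
        Ideal.Quotient.nontrivial_iff.2 (by simpa using hne 1 le_rfl)
      exact ringKrullDimZero_iff_ringKrullDim_eq_zero.1
        (SatDegree.krullDimLE_zero_of_forall_mem hst
          ⟨_, by simpa using (hforms 1 le_rfl _).2 le_rfl⟩)
    · exact (SatDegree.sdeg_eq_coe_iff _ (hne n hn) ⟨_, (hforms n hn _).2 le_rfl⟩).2 (hforms n hn)
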